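/- Let $\mathbb K$ be $\mathbb R$ or $\mathbb C$, let $X$ be a Banach space over $\mathbb K$, and let $\Omega$ be a compact Hausdorff space. Let $\mathcal C(\Omega)$ be the space of continuous functions $\Omega\to\mathbb K$ with the supremum norm, and write $\mathcal L(E,F)$ for the space of bounded linear operators from $E$ to $F$ with the operator norm. Let $\mathcal C_1(\Omega,X)$ be the space of all continuous functions $f:\Omega\to X$ for which there is an absolutely summable sequence $(x_n)$ in $X$ with $$f(\Omega)\subset\Big\{\sum_{n}\alpha_n x_n \;:\; \alpha_n\in\mathbb K,\ |\alpha_n|\le 1 \text{ for all } n\Big\},$$ normed by $\|f\|_{\mathcal C_1(\Omega,X)}=\inf\sum_n\|x_n\|$, the infimum being taken over all such sequences $(x_n)$. For a Banach space $Y$ over $\mathbb K$ and $U\in\mathcal L(\mathcal C_1(\Omega,X),Y)$, the associated operator $U^{\#}\in\mathcal L(\mathcal C(\Omega),\mathcal L(X,Y))$ is defined by $(U^{\#}\varphi)x=U(\varphi x)$ for $\varphi\in\mathcal C(\Omega)$ and $x\in X$, where $\varphi x$ denotes the function $\omega\mapsto\varphi(\omega)x$. Then for every Banach space $Y$ over $\mathbb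 K$ and every $S\in\mathcal L(\mathcal C(\Omega),\mathcal L(X,Y))$ there exists $U\in\mathcal L(\mathcal C_1(\Omega,X),Y)$ such that $U^{\#}=S$. -/

import Mathlib

noncomputable section

namespace OneCont

/-- The set `{∑ αₙ xₙ : (αₙ) in the closed unit ball of ℓ_∞}` generated by a sequence `(xₙ)`. -/
def hull (𝕜 : Type*) [RCLike 𝕜] {X : Type*} [NormedAddCommGroup X] [NormedSpace 𝕜 X]
    (x : ℕ → X) : Set X :=
  {y | ∃ α : ℕ → 𝕜, (∀ n, ‖α n‖ ≤ 1) ∧ HasSum (fun n => α n • x n) y}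

/-- `x` is an absolutely summable sequence, `x ∈ ℓ₁(X)`, whose hull contains `K`. -/
def Dominates (𝕜 : Type*) [RCLike 𝕜] {X : Type*} [NormedAddCommGroup X] [NormedSpace 𝕜 X]
    (x : ℕ → X) (K : Set X) : Prop :=
  Summable (fun n => ‖x n‖) ∧ K ⊆ hull 𝕜 x

/-- A set is `1`-compact if it lies in the hull of some sequence of `ℓ₁(X)`. -/
def IsOneCompact (𝕜 : Type*) [RCLike 𝕜] {X : Type*} [NormedAddCommGroup X] [NormedSpace 𝕜 X]
    (K : Set X) : Prop :=
  ∃ x : ℕ → X, Dominates 𝕜 x K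

theorem dominates_zero {𝕜 : Type*} [RCLike 𝕜] {Ω : Type*} [TopologicalSpace Ω]
    {X : Type*} [NormedAddCommGroup X] [NormedSpace 𝕜 X] :
    Dominates 𝕜 (0 : ℕ → X) (Set.range (0 : C(Ω, X))) := by
  refine ⟨by simp, ?_⟩
  rintro _ ⟨w, rfl⟩
  exact ⟨0, by simp, by simp⟩

section

variable {𝕜 : Type*} [RCLike 𝕜] {Ω : Type*} [TopologicalSpace Ω]
  {X : Type*} [NormedAddCommGroup X] [NormedSpace 𝕜 X]

theorem dominates_add {x y : ℕ → X} {f g : C(Ω, X)} (hx : Dominates 𝕜 x (Set.range f))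
    (hy : Dominates 𝕜 y (Set.range g)) :
    ∃ z : ℕ → X, Dominates 𝕜 z (Set.range (f + g)) ∧
      ∑' n, ‖z n‖ = ∑' n, ‖x n‖ + ∑' n, ‖y n‖ := by
  let e := Equiv.natSumNatEquivNat
  have hs : HasSum (fun s : ℕ ⊕ ℕ => ‖Sum.elim x y s‖) (∑' n, ‖x n‖ + ∑' n, ‖y n‖) :=
    HasSum.sum (f := fun s : ℕ ⊕ ℕ => ‖Sum.elim x y s‖) hx.1.hasSum hy.1.hasSum
  have hs' := (e.symm.hasSum_iff (f := fun s : ℕ ⊕ ℕ => ‖Sum.elim x y s‖)).2 hs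
  refine ⟨fun n => Sum.elim x y (e.symm n), ⟨hs'.summable, ?_⟩, hs'.tsum_eq⟩
  rintro _ ⟨w, rfl⟩
  obtain ⟨α, hα, hα'⟩ := hx.2 ⟨w, rfl⟩
  obtain ⟨β, hβ, hβ'⟩ := hy.2 ⟨w, rfl⟩
  refine ⟨fun n => Sum.elim α β (e.symm n), fun n => ?_, ?_⟩
  · show ‖Sum.elim α β (e.symm n)‖ ≤ 1
    rcases e.symm n with k | k
    · exact hα k
    · exact hβ k
  · have h := HasSum.sum (f := fun s : ℕ ⊕ ℕ => Sum.elim α β s • Sum.elim x y s) hα' hβ'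
    exact (e.symm.hasSum_iff (f := fun s : ℕ ⊕ ℕ => Sum.elim α β s • Sum.elim x y s)).2 h

theorem dominates_smul (c : 𝕜) {x : ℕ → X} {f : C(Ω, X)} (hx : Dominates 𝕜 x (Set.range f)) :
    Dominates 𝕜 (fun n => c • x n) (Set.range (c • f)) ∧
      ∑' n, ‖c • x n‖ = ‖c‖ * ∑' n, ‖x n‖ := by
  refine ⟨⟨?_, ?_⟩, ?_⟩
  · simpa only [norm_smul] using hx.1.mul_left ‖c‖
  · rintro _ ⟨w, rfl⟩
    obtain ⟨α, hα, hα'⟩ := hx.2 ⟨w, rfl⟩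
    refine ⟨α, hα, ?_⟩
    have h := hα'.const_smul c
    simp only [smul_comm c] at h
    exact h
  · simp only [norm_smul, tsum_mul_left]

theorem Dominates.norm_le [CompactSpace Ω] {x : ℕ → X} {f : C(Ω, X)} (hx : Dominates 𝕜 x (Set.range f)) :
    ‖f‖ ≤ ∑' n, ‖x n‖ := by
  refine (ContinuousMap.norm_le f (tsum_nonneg fun n => norm_nonneg _)).2 fun w => ?_
  obtain ⟨α, hα, hα'⟩ := hx.2 ⟨w, rfl⟩
  rw [← hα'.tsum_eq]
  refine tsum_of_norm_bounded hx.1.hasSum fun n => ?_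
  rw [norm_smul]
  exact mul_le_of_le_one_left (norm_nonneg _) (hα n)

end

/-- The linear subspace of `C(Ω, X)` of the functions with `1`-compact range. -/
def submodule (𝕜 : Type*) [RCLike 𝕜] (Ω : Type*) [TopologicalSpace Ω] [CompactSpace Ω]
    (X : Type*) [NormedAddCommGroup X] [NormedSpace 𝕜 X] : Submodule 𝕜 C(Ω, X) where
  carrier := {f | IsOneCompact 𝕜 (Set.range f)}
  zero_mem' := ⟨0, dominates_zero⟩
  add_mem' := by
    rintro f g ⟨x, hx⟩ ⟨y, hy⟩
    obtain ⟨z, hz, -⟩ := dominates_add hx hy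
    exact ⟨z, hz⟩
  smul_mem' := by
    rintro c f ⟨x, hx⟩
    exact ⟨_, (dominates_smul c hx).1⟩

end OneCont

/-- The space `C₁(Ω, X)` of `1`-continuous functions. This is a type synonym of the subspace of
`C(Ω, X)`, so that it does not inherit the supremum norm; its norm is defined below. -/
def C1 (𝕜 : Type*) [RCLike 𝕜] (Ω : Type*) [TopologicalSpace Ω] [CompactSpace Ω]
    (X : Type*) [NormedAddCommGroup X] [NormedSpace 𝕜 X] : Type _ :=
  OneCont.submodule 𝕜 Ω X

namespace C1

variable {𝕜 : Type*} [RCLike 𝕜] {Ω : Type*} [TopologicalSpace Ω] [CompactSpace Ω]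
  {X : Type*} [NormedAddCommGroup X] [NormedSpace 𝕜 X]

instance : AddCommGroup (C1 𝕜 Ω X) := inferInstanceAs (AddCommGroup (OneCont.submodule 𝕜 Ω X))

instance : Module 𝕜 (C1 𝕜 Ω X) := inferInstanceAs (Module 𝕜 (OneCont.submodule 𝕜 Ω X))

/-- The underlying continuous function. -/
def toContinuousMap (f : C1 𝕜 Ω X) : C(Ω, X) := f.1

/-- An element of `C₁(Ω, X)` from a continuous function with `1`-compact range. -/
def mk (f : C(Ω, X)) (hf : OneCont.IsOneCompact 𝕜 (Set.range f)) : C1 𝕜 Ω X := ⟨f, hf⟩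

/-- The values `‖x‖₁`, for `x ∈ ℓ₁(X)` a sequence whose hull contains `f(Ω)`. -/
def costs (f : C1 𝕜 Ω X) : Set ℝ :=
  {r | ∃ x : ℕ → X, OneCont.Dominates 𝕜 x (Set.range f.toContinuousMap) ∧ r = ∑' n, ‖x n‖}

/-- The norm of `C₁(Ω, X)`. -/
instance : Norm (C1 𝕜 Ω X) := ⟨fun f => sInf f.costs⟩

theorem norm_def (f : C1 𝕜 Ω X) : ‖f‖ = sInf f.costs := rfl

theorem costs_nonempty (f : C1 𝕜 Ω X) : f.costs.Nonempty := by
  obtain ⟨x, hx⟩ := f.2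
  exact ⟨_, x, hx, rfl⟩

theorem sup_norm_le_of_mem {f : C1 𝕜 Ω X} {r : ℝ} (hr : r ∈ f.costs) :
    ‖f.toContinuousMap‖ ≤ r := by
  obtain ⟨x, hx, rfl⟩ := hr
  exact hx.norm_le

theorem bddBelow_costs (f : C1 𝕜 Ω X) : BddBelow f.costs :=
  ⟨_, fun _ hr => sup_norm_le_of_mem hr⟩

theorem sup_norm_le (f : C1 𝕜 Ω X) : ‖f.toContinuousMap‖ ≤ ‖f‖ :=
  le_csInf f.costs_nonempty fun _ hr => sup_norm_le_of_mem hr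

theorem norm_nonneg_aux (f : C1 𝕜 Ω X) : 0 ≤ ‖f‖ :=
  le_trans (norm_nonneg f.toContinuousMap) f.sup_norm_le

theorem norm_le_of_mem {f : C1 𝕜 Ω X} {r : ℝ} (hr : r ∈ f.costs) : ‖f‖ ≤ r :=
  csInf_le f.bddBelow_costs hr

theorem norm_smul_le_aux (c : 𝕜) (f : C1 𝕜 Ω X) : ‖c • f‖ ≤ ‖c‖ * ‖f‖ := by
  refine le_of_forall_pos_le_add fun ε hε => ?_
  have hδ : 0 < ε / (‖c‖ + 1) := by positivity
  obtain ⟨_, ⟨x, hx, rfl⟩, hlt⟩ := exists_lt_of_csInf_lt f.costs_nonempty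
    (lt_add_of_pos_right (sInf f.costs) hδ)
  have h := OneCont.dominates_smul c hx
  have h1 : ‖c • f‖ ≤ ‖c‖ * ∑' n, ‖x n‖ := norm_le_of_mem ⟨_, h.1, h.2.symm⟩
  have h2 : ‖c‖ * ∑' n, ‖x n‖ ≤ ‖c‖ * (‖f‖ + ε / (‖c‖ + 1)) :=
    mul_le_mul_of_nonneg_left hlt.le (norm_nonneg c)
  have h3 : ‖c‖ * (ε / (‖c‖ + 1)) ≤ ε := by
    rw [mul_div_assoc', div_le_iff₀ (by positivity)]
    nlinarith [norm_nonneg c]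
  linarith [mul_add ‖c‖ ‖f‖ (ε / (‖c‖ + 1))]

theorem core : NormedSpace.Core 𝕜 (C1 𝕜 Ω X) where
  norm_nonneg f := norm_nonneg_aux f
  norm_smul c f := by
    refine le_antisymm (norm_smul_le_aux c f) ?_
    rcases eq_or_ne c 0 with rfl | hc
    · rw [norm_zero, zero_mul]
      exact norm_nonneg_aux _
    · have h := norm_smul_le_aux c⁻¹ (c • f)
      rw [inv_smul_smul₀ hc, norm_inv] at h
      have hc' : 0 < ‖c‖ := norm_pos_iff.2 hc
      calc ‖c‖ * ‖f‖ ≤ ‖c‖ * (‖c‖⁻¹ * ‖c • f‖) := mul_le_mul_of_nonneg_left h hc'.le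
        _ = ‖c • f‖ := by rw [mul_inv_cancel_left₀ hc'.ne']
  norm_triangle f g := by
    refine le_of_forall_pos_le_add fun ε hε => ?_
    obtain ⟨_, ⟨x, hx, rfl⟩, hlt⟩ := exists_lt_of_csInf_lt f.costs_nonempty
      (lt_add_of_pos_right (sInf f.costs) (half_pos hε))
    obtain ⟨_, ⟨y, hy, rfl⟩, hlt'⟩ := exists_lt_of_csInf_lt g.costs_nonempty
      (lt_add_of_pos_right (sInf g.costs) (half_pos hε))
    obtain ⟨z, hz, hz'⟩ := OneCont.dominates_add hx hy
    have h1 : ‖f + g‖ ≤ ∑' n, ‖x n‖ + ∑' n, ‖y n‖ := norm_le_of_mem ⟨z, hz, hz'.symm⟩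
    rw [← norm_def] at hlt hlt'
    linarith
  norm_eq_zero_iff f := by
    constructor
    · intro h
      have h0 : f.toContinuousMap = 0 := norm_le_zero_iff.1 (h ▸ f.sup_norm_le)
      exact Subtype.ext h0
    · rintro rfl
      refine le_antisymm ?_ (norm_nonneg_aux _)
      exact norm_le_of_mem ⟨0, OneCont.dominates_zero, by simp⟩

instance : NormedAddCommGroup (C1 𝕜 Ω X) := NormedAddCommGroup.ofCore (𝕜 := 𝕜) core

instance : NormedSpace 𝕜 (C1 𝕜 Ω X) := NormedSpace.ofCore core

/-- The function `φx : ω ↦ φ(ω) x`. -/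
def tmulMap (φ : C(Ω, 𝕜)) (x : X) : C(Ω, X) := ⟨fun w => φ w • x, by fun_prop⟩

theorem dominates_tmul (φ : C(Ω, 𝕜)) (x : X) :
    OneCont.Dominates 𝕜 (Pi.single 0 ((‖φ‖ : 𝕜) • x)) (Set.range (tmulMap φ x)) ∧
      ‖φ‖ * ‖x‖ = ∑' n, ‖(Pi.single 0 ((‖φ‖ : 𝕜) • x) : ℕ → X) n‖ := by
  have hs : HasSum (fun n => ‖(Pi.single 0 ((‖φ‖ : 𝕜) • x) : ℕ → X) n‖) (‖φ‖ * ‖x‖) := by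
    convert hasSum_single (f := fun n => ‖(Pi.single 0 ((‖φ‖ : 𝕜) • x) : ℕ → X) n‖) 0
      (fun n hn => by simp [Pi.single_eq_of_ne hn]) using 1
    simp [norm_smul]
  refine ⟨⟨hs.summable, ?_⟩, hs.tsum_eq.symm⟩
  rintro _ ⟨w, rfl⟩
  refine ⟨fun _ => φ w / (‖φ‖ : 𝕜), fun _ => ?_, ?_⟩
  · rw [norm_div, RCLike.norm_ofReal, abs_norm]
    exact div_le_one_of_le₀ (φ.norm_coe_le_norm w) (norm_nonneg _)
  · convert hasSum_single (f := fun n => (φ w / (‖φ‖ : 𝕜)) •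
      (Pi.single 0 ((‖φ‖ : 𝕜) • x) : ℕ → X) n) 0
      (fun n hn => by simp [Pi.single_eq_of_ne hn]) using 1
    rcases eq_or_ne φ 0 with rfl | hφ
    · simp [tmulMap]
    · have : (‖φ‖ : 𝕜) ≠ 0 := by simpa using hφ
      simp [tmulMap, smul_smul, div_mul_cancel₀ _ this]

/-- The function `φx : ω ↦ φ(ω) x` as an element of `C₁(Ω, X)`. -/
def tmul (φ : C(Ω, 𝕜)) (x : X) : C1 𝕜 Ω X := mk (tmulMap φ x) ⟨_, (dominates_tmul φ x).1⟩

theorem norm_tmul_le (φ : C(Ω, 𝕜)) (x : X) : ‖tmul φ x‖ ≤ ‖φ‖ * ‖x‖ :=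
  norm_le_of_mem ⟨_, dominates_tmul φ x⟩

variable {Y : Type*} [NormedAddCommGroup Y] [NormedSpace 𝕜 Y]

/-- The operator `U^# : C(Ω) → L(X, Y)` associated to `U : C₁(Ω, X) → Y`, given by
`(U^# φ) x = U (φx)`. -/
def assoc (U : C1 𝕜 Ω X →L[𝕜] Y) : C(Ω, 𝕜) →L[𝕜] X →L[𝕜] Y :=
  LinearMap.mkContinuous₂
    (LinearMap.mk₂ 𝕜 (fun (φ : C(Ω, 𝕜)) (x : X) => U (tmul φ x))
      (fun φ ψ x => by
        rw [← map_add]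
        exact congrArg U (Subtype.ext (ContinuousMap.ext fun w => add_smul (φ w) (ψ w) x)))
      (fun c φ x => by
        rw [← map_smul]
        exact congrArg U (Subtype.ext (ContinuousMap.ext fun w => smul_assoc c (φ w) x)))
      (fun φ x y => by
        rw [← map_add]
        exact congrArg U (Subtype.ext (ContinuousMap.ext fun w => smul_add (φ w) x y)))
      (fun c φ x => by
        rw [← map_smul]
        exact congrArg U (Subtype.ext (ContinuousMap.ext fun w => smul_comm (φ w) c x))))
    ‖U‖ (fun φ x => by
      rw [mul_assoc]
      exact (U.le_opNorm _).trans
        (mul_le_mul_of_nonneg_left (norm_tmul_le φ x) (norm_nonneg U)))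

theorem assoc_apply (U : C1 𝕜 Ω X →L[𝕜] Y) (φ : C(Ω, 𝕜)) (x : X) :
    assoc U φ x = U (tmul φ x) := rfl

end C1

end

/-! The operator `S` induces a linear map on `C(Ω) ⊗ X`. It extends to `C₁(Ω, X)` once the tensors
are dense there and the map is bounded for the `C₁` norm. Both facts come from the sums `∑ ψ_w f(w)`
over fine partitions of unity.

Bound (`norm_sum_apply_eval_le`): if `f(w) = ∑ α_n(w) x_n`, then `∑_w S(ψ_w) f(w) = ∑_n S(∑_w α_n(w)
ψ_w) x_n`. Each inner sum has sup norm at most `1`, although `α_n` need not be continuous, so the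
total is at most `‖S‖ ∑ ‖x_n‖`. For a tensor, these sums tend to its image as the partition refines.

Density (`denseRange_ofTensor`): the error at `v` is an average of differences `f(v) - f(w)` of
small norm. By compactness (`exists_small_hull`), such differences lie in one hull of small cost, so
the error is small in `C₁` and not merely uniformly. -/

open Filter Topology Uniformity TensorProduct

/-! ### Hulls of absolutely summable sequences -/

namespace OneCont

variable {𝕜 : Type*} [RCLike 𝕜] {X : Type*} [NormedAddCommGroup X] [NormedSpace 𝕜 X]

theorem sub_mem_hull {x : ℕ → X} {y z : X} (hy : y ∈ hull 𝕜 x) (hz : z ∈ hull 𝕜 x) :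
    y - z ∈ hull 𝕜 (fun n => (2 : 𝕜) • x n) := by
  obtain ⟨α, hα, hα'⟩ := hy
  obtain ⟨β, hβ, hβ'⟩ := hz
  refine ⟨fun n => 2⁻¹ * (α n - β n), fun n => ?_, ?_⟩
  · rw [norm_mul, norm_inv, RCLike.norm_ofNat]
    linarith [norm_sub_le (α n) (β n), hα n, hβ n]
  · convert hα'.sub hβ' using 2 with n
    rw [smul_smul, mul_right_comm, inv_mul_cancel₀ two_ne_zero, one_mul, sub_smul]

/-- Hulls are absolutely convex. Terms with zero coefficient are exempt because a partition of unity
controls `f v - f w` only where `ψ w v ≠ 0`. -/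
theorem sum_smul_mem_hull {ι : Type*} {x : ℕ → X} (T : Finset ι) {c : ι → 𝕜} {z : ι → X}
    (hc : ∑ i ∈ T, ‖c i‖ ≤ 1) (hz : ∀ i ∈ T, c i ≠ 0 → z i ∈ hull 𝕜 x) :
    ∑ i ∈ T, c i • z i ∈ hull 𝕜 x := by
  have h : ∀ i, ∃ α : ℕ → 𝕜, (∀ n, ‖α n‖ ≤ 1) ∧
      (i ∈ T → HasSum (fun n => c i • α n • x n) (c i • z i)) := by
    intro i
    by_cases hi : i ∈ T ∧ c i ≠ 0
    · obtain ⟨α, hα, hα'⟩ := hz i hi.1 hi.2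
      exact ⟨α, hα, fun _ => hα'.const_smul _⟩
    · refine ⟨0, by simp, fun hT => ?_⟩
      have : c i = 0 := by simpa [hT] using hi
      simp [this]
  choose α hα hα' using h
  refine ⟨fun n => ∑ i ∈ T, c i * α i n, fun n => ?_, ?_⟩
  · refine (norm_sum_le _ _).trans ((Finset.sum_le_sum fun i _ => ?_).trans hc)
    rw [norm_mul]
    exact mul_le_of_le_one_right (norm_nonneg _) (hα i n)
  · simpa only [Finset.sum_smul, mul_smul] using hasSum_sum fun i hi => hα' i hi

/-- Positive weights, equal to `4` off a finite set, whose weighted sum is small. -/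
theorem exists_weights {a : ℕ → ℝ} (ha : Summable a) (ha0 : ∀ n, 0 ≤ a n) {η : ℝ} (hη : 0 < η) :
    ∃ (m : ℕ → ℝ) (N : ℕ), (∀ n, 0 < m n) ∧ (∀ n, N ≤ n → m n = 4) ∧
      Summable (fun n => m n * a n) ∧ ∑' n, m n * a n ≤ η := by
  -- The tail costs at most `4 * (η / 8)`, which leaves `η / 2` for the head.
  obtain ⟨N, hN⟩ := ((tendsto_sum_nat_add a).eventually_lt_const
    (show 0 < η / 8 by positivity)).exists
  have hA : 0 ≤ ∑' n, a n := tsum_nonneg ha0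
  set c := η / (2 * (∑' n, a n + 1)) with hc
  have hc0 : 0 < c := by positivity
  set m : ℕ → ℝ := fun n => if n < N then c else 4
  have hm : ∀ n, N ≤ n → m n = 4 := fun n hn => if_neg hn.not_gt
  have hs : Summable (fun n => m n * a n) := by
    rw [← summable_nat_add_iff N]
    simp only [hm _ (Nat.le_add_left N _)]
    exact ((summable_nat_add_iff N).2 ha).mul_left 4
  refine ⟨m, N, fun n => ?_, hm, hs, ?_⟩
  · show 0 < if n < N then c else 4
    split_ifs <;> positivity
  · rw [← hs.sum_add_tsum_nat_add N]
    simp only [hm _ (Nat.le_add_left N _), tsum_mul_left]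
    have h1 : ∑ n ∈ Finset.range N, m n * a n = c * ∑ n ∈ Finset.range N, a n := by
      rw [Finset.mul_sum]
      refine Finset.sum_congr rfl fun n hn => ?_
      rw [show m n = c from if_pos (Finset.mem_range.1 hn)]
    have h2 : c * ∑ n ∈ Finset.range N, a n ≤ c * (∑' n, a n + 1) :=
      mul_le_mul_of_nonneg_left
        ((ha.sum_le_tsum _ fun n _ => ha0 n).trans (le_add_of_nonneg_right zero_le_one)) hc0.le
    have h3 : c * (∑' n, a n + 1) = η / 2 := by
      rw [hc]; field_simp
    linarith

/-- The elements of small norm of a `1`-compact hull lie in a fixed hull of small cost. -/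
theorem exists_small_hull [CompleteSpace X] {x : ℕ → X} (hx : Summable fun n => ‖x n‖)
    {η : ℝ} (hη : 0 < η) :
    ∃ y : ℕ → X, Summable (fun n => ‖y n‖) ∧ ∑' n, ‖y n‖ ≤ η ∧
      ∃ δ > 0, ∀ z ∈ hull 𝕜 (fun n => (2 : 𝕜) • x n), ‖z‖ < δ → z ∈ hull 𝕜 y := by
  obtain ⟨m, N, hm0, hm4, hms, hmη⟩ := exists_weights hx (fun n => norm_nonneg _) hη
  have hy : ∀ n, ‖(m n : 𝕜) • x n‖ = m n * ‖x n‖ := fun n => by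
    rw [norm_smul, RCLike.norm_ofReal, abs_of_pos (hm0 n)]
  refine ⟨fun n => (m n : 𝕜) • x n, by simpa only [hy] using hms, by simpa only [hy] using hmη, ?_⟩
  -- Otherwise there are `z k → 0` outside the hull; by Tychonoff their coefficients converge
  -- coordinatewise along a subsequence to some `a`.
  by_contra! hcon
  choose z hz hzlt hzn using fun k : ℕ => hcon (1 / ((k : ℝ) + 1)) (by positivity)
  choose α hα hα' using hz
  have hK : IsCompact (Set.univ.pi fun _ : ℕ => Metric.closedBall (0 : 𝕜) 1) :=
    isCompact_univ_pi fun _ => isCompact_closedBall _ _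
  obtain ⟨a, ha, φ, hφ, hlim⟩ := hK.tendsto_subseq (x := α)
    fun k n _ => by simpa using hα k n
  have ha1 : ∀ n, ‖a n‖ ≤ 1 := fun n => by simpa using ha n (Set.mem_univ n)
  rw [tendsto_pi_nhds] at hlim
  have hx2 : Summable fun n => ‖(2 : 𝕜) • x n‖ := by
    simpa only [norm_smul] using hx.mul_left ‖(2 : 𝕜)‖
  have hbound : ∀ b : 𝕜, ‖b‖ ≤ 1 → ∀ n, ‖b • (2 : 𝕜) • x n‖ ≤ ‖(2 : 𝕜) • x n‖ := fun b hb n => by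
    rw [norm_smul]
    exact mul_le_of_le_one_left (norm_nonneg _) hb
  have hsum : Summable fun n => a n • (2 : 𝕜) • x n :=
    Summable.of_norm_bounded hx2 fun n => hbound _ (ha1 n) n
  have hz0 : Tendsto z atTop (𝓝 0) :=
    squeeze_zero_norm (fun k => (hzlt k).le) tendsto_one_div_add_atTop_nhds_zero_nat
  have h1 : Tendsto (fun k => ∑' n, α (φ k) n • (2 : 𝕜) • x n) atTop
      (𝓝 (∑' n, a n • (2 : 𝕜) • x n)) :=
    tendsto_tsum_of_dominated_convergence hx2 (fun n => (hlim n).smul_const _)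
      (Eventually.of_forall fun k n => hbound _ (hα _ n) n)
  -- The limit coefficients represent `0`, so subtracting them leaves `z (φ k)` unchanged.
  have h0 : ∑' n, a n • (2 : 𝕜) • x n = 0 := by
    refine tendsto_nhds_unique h1 ?_
    simp only [fun k => (hα' (φ k)).tsum_eq]
    exact hz0.comp hφ.tendsto_atTop
  have hev : ∀ᶠ k in atTop, ∀ n ∈ Finset.range N, ‖α (φ k) n - a n‖ < m n / 2 := by
    rw [eventually_all_finset]
    intro n _
    have := (((hlim n).sub_const (a n)).norm)
    rw [sub_self, norm_zero] at this
    exact this.eventually_lt_const (half_pos (hm0 n))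
  obtain ⟨k, hk⟩ := hev.exists
  -- These coefficients have norm at most `1`: for `n < N` by convergence, beyond `N` because `2 *
  -- (1 + 1) = 4 = m n`.
  refine hzn (φ k) ⟨fun n => (m n : 𝕜)⁻¹ * (2 * (α (φ k) n - a n)), fun n => ?_, ?_⟩
  · rw [norm_mul, norm_inv, norm_mul, RCLike.norm_ofNat, RCLike.norm_ofReal, abs_of_pos (hm0 n),
      inv_mul_le_iff₀ (hm0 n), mul_one]
    by_cases hn : n < N
    · linarith [hk n (Finset.mem_range.2 hn)]
    · rw [hm4 n (not_lt.1 hn)]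
      linarith [norm_sub_le (α (φ k) n) (a n), hα (φ k) n, ha1 n]
  · have h := (hα' (φ k)).sub hsum.hasSum
    rw [h0, sub_zero] at h
    convert h using 2 with n
    have : (m n : 𝕜) ≠ 0 := by simpa using (hm0 n).ne'
    rw [smul_smul, mul_right_comm, inv_mul_cancel₀ this, one_mul, ← sub_smul, smul_smul, mul_comm]

/-! ### Fine partitions of unity -/

/-- A finite continuous partition of unity `(ψ w)_{w ∈ T}` such that `ψ w` is supported in the
`V`-neighbourhood of `w`. -/
structure IsFinePartition {Ω : Type*} [TopologicalSpace Ω] (V : Set (Ω × Ω)) (T : Finset Ω)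
    (ψ : Ω → C(Ω, 𝕜)) : Prop where
  sum_eq_one : ∀ v, ∑ w ∈ T, ψ w v = 1
  sum_norm_le_one : ∀ v, ∑ w ∈ T, ‖ψ w v‖ ≤ 1
  mem_of_ne_zero : ∀ w v, ψ w v ≠ 0 → (v, w) ∈ V

theorem IsFinePartition.mono {Ω : Type*} [TopologicalSpace Ω] {V W : Set (Ω × Ω)} {T : Finset Ω}
    {ψ : Ω → C(Ω, 𝕜)} (h : IsFinePartition V T ψ) (hVW : V ⊆ W) : IsFinePartition W T ψ :=
  ⟨h.1, h.2, fun w v hv => hVW (h.3 w v hv)⟩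

theorem IsFinePartition.norm_sum_smul_le {Ω : Type*} [TopologicalSpace Ω] [CompactSpace Ω]
    {V : Set (Ω × Ω)} {T : Finset Ω} {ψ : Ω → C(Ω, 𝕜)} (h : IsFinePartition V T ψ)
    {c : Ω → 𝕜} (hc : ∀ w, ‖c w‖ ≤ 1) : ‖∑ w ∈ T, c w • ψ w‖ ≤ 1 := by
  refine (ContinuousMap.norm_le _ zero_le_one).2 fun v => ?_
  simp only [ContinuousMap.coe_sum, Finset.sum_apply, ContinuousMap.coe_smul, Pi.smul_apply]
  refine (norm_sum_le _ _).trans ((Finset.sum_le_sum fun w _ => ?_).trans (h.sum_norm_le_one v))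
  rw [norm_smul]
  exact mul_le_of_le_one_left (norm_nonneg _) (hc w)

theorem exists_isFinePartition {Ω : Type*} [UniformSpace Ω] [CompactSpace Ω] [T2Space Ω]
    {V : Set (Ω × Ω)} (hV : V ∈ 𝓤 Ω) :
    ∃ (T : Finset Ω) (ψ : Ω → C(Ω, 𝕜)), IsFinePartition V T ψ := by
  obtain ⟨ρ, hρ⟩ := PartitionOfUnity.exists_isSubordinate (X := Ω) isClosed_univ
    (fun w : Ω => interior {v | (v, w) ∈ V}) (fun w => isOpen_interior)
    (fun w _ => Set.mem_iUnion.2 ⟨w, mem_interior_iff_mem_nhds.2 (mem_nhds_right w hV)⟩)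
  have hfin := ρ.locallyFinite.finite_nonempty_of_compact
  have hsum : ∀ v, ∑ w ∈ hfin.toFinset, ρ w v = 1 := fun v => by
    refine ρ.sum_finsupport' (Set.mem_univ v) fun w hw => ?_
    rw [Set.Finite.mem_toFinset]
    exact ⟨v, (ρ.mem_finsupport v).1 hw⟩
  refine ⟨hfin.toFinset, fun w => ⟨fun v => (ρ w v : 𝕜), by fun_prop⟩, fun v => ?_, fun v => ?_,
    fun w v hv => ?_⟩
  · simp only [ContinuousMap.coe_mk, ← RCLike.ofReal_sum, hsum v, RCLike.ofReal_one]
  · simp only [ContinuousMap.coe_mk, RCLike.norm_ofReal, abs_of_nonneg (ρ.nonneg _ v)]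
    exact (hsum v).le
  · have hv' : ρ w v ≠ 0 := by simpa using hv
    have := hρ w (subset_tsupport _ hv')
    exact interior_subset (s := {v | (v, w) ∈ V}) this

end OneCont

/-! ### Tensors and the operator bound -/

namespace C1

open OneCont

section

variable {𝕜 : Type*} [RCLike 𝕜] {Ω : Type*} [TopologicalSpace Ω] [CompactSpace Ω]
  {X : Type*} [NormedAddCommGroup X] [NormedSpace 𝕜 X]
  {Y : Type*} [NormedAddCommGroup Y] [NormedSpace 𝕜 Y]

/-- Evaluation at a point, as a linear map. -/
def evalLinear (w : Ω) : C1 𝕜 Ω X →ₗ[𝕜] X where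
  toFun f := f.toContinuousMap w
  map_add' _ _ := rfl
  map_smul' _ _ := rfl

/-- The canonical map `C(Ω) ⊗ X → C₁(Ω, X)`. -/
def ofTensor (𝕜 : Type*) [RCLike 𝕜] (Ω : Type*) [TopologicalSpace Ω] [CompactSpace Ω]
    (X : Type*) [NormedAddCommGroup X] [NormedSpace 𝕜 X] :
    C(Ω, 𝕜) ⊗[𝕜] X →ₗ[𝕜] C1 𝕜 Ω X :=
  TensorProduct.lift (LinearMap.mk₂ 𝕜 tmul
    (fun φ ψ x => Subtype.ext (ContinuousMap.ext fun w => add_smul (φ w) (ψ w) x))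
    (fun c φ x => Subtype.ext (ContinuousMap.ext fun w => smul_assoc c (φ w) x))
    (fun φ x y => Subtype.ext (ContinuousMap.ext fun w => smul_add (φ w) x y))
    (fun c φ x => Subtype.ext (ContinuousMap.ext fun w => smul_comm (φ w) c x)))

theorem ofTensor_tmul (φ : C(Ω, 𝕜)) (x : X) : ofTensor 𝕜 Ω X (φ ⊗ₜ x) = tmul φ x := rfl

theorem eval_tmul (φ : C(Ω, 𝕜)) (x : X) (w : Ω) : evalLinear w (tmul φ x) = φ w • x := rfl

/-- The linear map `C(Ω) ⊗ X → Y` induced by `S`. -/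
def tensorLift (S : C(Ω, 𝕜) →L[𝕜] X →L[𝕜] Y) : C(Ω, 𝕜) ⊗[𝕜] X →ₗ[𝕜] Y :=
  TensorProduct.lift ((ContinuousLinearMap.coeLM 𝕜).comp S.toLinearMap)

theorem norm_sum_apply_eval_le (S : C(Ω, 𝕜) →L[𝕜] X →L[𝕜] Y) (f : C1 𝕜 Ω X)
    {V : Set (Ω × Ω)} {T : Finset Ω} {ψ : Ω → C(Ω, 𝕜)} (h : IsFinePartition V T ψ) :
    ‖∑ w ∈ T, S (ψ w) (evalLinear w f)‖ ≤ ‖S‖ * ‖f‖ := by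
  have key : ∀ r ∈ f.costs, ‖∑ w ∈ T, S (ψ w) (evalLinear w f)‖ ≤ ‖S‖ * r := by
    rintro _ ⟨x, hx, rfl⟩
    choose α hα hα' using fun w => hx.2 ⟨w, rfl⟩
    have hs : HasSum (fun n => S (∑ w ∈ T, α w n • ψ w) (x n))
        (∑ w ∈ T, S (ψ w) (evalLinear w f)) := by
      convert hasSum_sum (s := T) fun w _ => (S (ψ w)).hasSum (hα' w) using 2 with n
      · simp
      · rfl
    rw [← hs.tsum_eq]
    refine tsum_of_norm_bounded (hx.1.hasSum.mul_left ‖S‖) fun n => ?_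
    refine (ContinuousLinearMap.le_opNorm _ _).trans
      (mul_le_mul_of_nonneg_right ?_ (norm_nonneg _))
    exact (S.le_opNorm _).trans (mul_le_of_le_one_right (norm_nonneg _)
      (h.norm_sum_smul_le fun w => hα w n))
  refine le_of_forall_pos_le_add fun ε hε => ?_
  obtain ⟨r, hr, hlt⟩ := exists_lt_of_csInf_lt f.costs_nonempty
    (lt_add_of_pos_right (sInf f.costs) (show 0 < ε / (‖S‖ + 1) by positivity))
  rw [← norm_def] at hlt
  have h1 : ‖S‖ * r ≤ ‖S‖ * (‖f‖ + ε / (‖S‖ + 1)) :=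
    mul_le_mul_of_nonneg_left hlt.le (norm_nonneg S)
  have h2 : ‖S‖ * (ε / (‖S‖ + 1)) ≤ ε := by
    rw [mul_div_assoc', div_le_iff₀ (by positivity)]
    nlinarith [norm_nonneg S]
  linarith [key r hr, mul_add ‖S‖ ‖f‖ (ε / (‖S‖ + 1))]

end

/-! ### Approximation along fine partitions -/

section

variable {𝕜 : Type*} [RCLike 𝕜] {Ω : Type*} [UniformSpace Ω] [CompactSpace Ω]
  {X : Type*} [NormedAddCommGroup X] [NormedSpace 𝕜 X]
  {Y : Type*} [NormedAddCommGroup Y] [NormedSpace 𝕜 Y]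

theorem exists_entourage_norm_sub_le {E : Type*} [NormedAddCommGroup E] (f : C(Ω, E)) {ε : ℝ}
    (hε : 0 < ε) : ∃ V ∈ 𝓤 Ω, ∀ v w, (v, w) ∈ V → ‖f v - f w‖ < ε := by
  refine ⟨_, CompactSpace.uniformContinuous_of_continuous f.continuous
    (Metric.dist_mem_uniformity hε), fun v w h => ?_⟩
  rw [← dist_eq_norm]
  exact h

theorem exists_entourage_norm_sub_sum_le (φ : C(Ω, 𝕜)) {ε : ℝ} (hε : 0 < ε) :
    ∃ V ∈ 𝓤 Ω, ∀ (T : Finset Ω) (ψ : Ω → C(Ω, 𝕜)), IsFinePartition V T ψ →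
      ‖φ - ∑ w ∈ T, φ w • ψ w‖ ≤ ε := by
  obtain ⟨V, hV, hφ⟩ := exists_entourage_norm_sub_le φ hε
  refine ⟨V, hV, fun T ψ h => (ContinuousMap.norm_le _ hε.le).2 fun v => ?_⟩
  have : (φ - ∑ w ∈ T, φ w • ψ w) v = ∑ w ∈ T, ψ w v * (φ v - φ w) := by
    simp only [mul_sub, Finset.sum_sub_distrib, ← Finset.sum_mul, h.sum_eq_one v, one_mul,
      ContinuousMap.sub_apply, ContinuousMap.sum_apply, ContinuousMap.smul_apply, smul_eq_mul,
      mul_comm (φ _)]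
  rw [this]
  calc ‖∑ w ∈ T, ψ w v * (φ v - φ w)‖ ≤ ∑ w ∈ T, ‖ψ w v‖ * ε := by
        refine (norm_sum_le _ _).trans (Finset.sum_le_sum fun w _ => ?_)
        rw [norm_mul]
        by_cases h0 : ψ w v = 0
        · simp [h0]
        · exact mul_le_mul_of_nonneg_left (hφ v w (h.mem_of_ne_zero w v h0)).le (norm_nonneg _)
    _ ≤ ε := by
        rw [← Finset.sum_mul]
        exact mul_le_of_le_one_left hε.le (h.sum_norm_le_one v)

/-- For `φ ⊗ x` the difference is `S (φ - ∑ φ(w) ψ_w) x`, small by uniform continuity of `φ`; for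
sums, entourages are intersected. -/
theorem exists_entourage_norm_tensorLift_sub_le (S : C(Ω, 𝕜) →L[𝕜] X →L[𝕜] Y)
    (t : C(Ω, 𝕜) ⊗[𝕜] X) : ∀ ε > 0,
    ∃ V ∈ 𝓤 Ω, ∀ (T : Finset Ω) (ψ : Ω → C(Ω, 𝕜)), IsFinePartition V T ψ →
      ‖tensorLift S t - ∑ w ∈ T, S (ψ w) (evalLinear w (ofTensor 𝕜 Ω X t))‖ ≤ ε := by
  induction t with
  | zero => exact fun ε hε => ⟨Set.univ, univ_mem, fun T ψ _ => by simpa using hε.le⟩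
  | tmul φ x =>
    intro ε hε
    have hC : 0 < ‖S‖ * ‖x‖ + 1 := by positivity
    obtain ⟨V, hV, h⟩ := exists_entourage_norm_sub_sum_le φ (div_pos hε hC)
    refine ⟨V, hV, fun T ψ hψ => ?_⟩
    have h1 : tensorLift S (φ ⊗ₜ x) - ∑ w ∈ T, S (ψ w) (evalLinear w (ofTensor 𝕜 Ω X (φ ⊗ₜ x)))
        = S (φ - ∑ w ∈ T, φ w • ψ w) x := by
      simp [tensorLift, ofTensor_tmul, eval_tmul]
    rw [h1]
    calc _ ≤ ‖S‖ * ‖φ - ∑ w ∈ T, φ w • ψ w‖ * ‖x‖ := S.le_opNorm₂ _ _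
      _ ≤ ‖S‖ * (ε / (‖S‖ * ‖x‖ + 1)) * ‖x‖ := by gcongr; exact h T ψ hψ
      _ = ‖S‖ * ‖x‖ * ε / (‖S‖ * ‖x‖ + 1) := by ring
      _ ≤ ε := by
        rw [div_le_iff₀ hC]
        nlinarith
  | add t s ht hs =>
    intro ε hε
    obtain ⟨V, hV, h⟩ := ht _ (half_pos hε)
    obtain ⟨W, hW, h'⟩ := hs _ (half_pos hε)
    refine ⟨V ∩ W, inter_mem hV hW, fun T ψ hψ => ?_⟩
    have h1 := h T ψ (hψ.mono Set.inter_subset_left)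
    have h2 := h' T ψ (hψ.mono Set.inter_subset_right)
    simp only [map_add, Finset.sum_add_distrib, add_sub_add_comm]
    exact (norm_add_le _ _).trans (by linarith)

theorem norm_tensorLift_le [T2Space Ω] (S : C(Ω, 𝕜) →L[𝕜] X →L[𝕜] Y) (t : C(Ω, 𝕜) ⊗[𝕜] X) :
    ‖tensorLift S t‖ ≤ ‖S‖ * ‖ofTensor 𝕜 Ω X t‖ := by
  refine le_of_forall_pos_le_add fun ε hε => ?_
  obtain ⟨V, hV, h⟩ := exists_entourage_norm_tensorLift_sub_le S t ε hε
  obtain ⟨T, ψ, hψ⟩ := exists_isFinePartition (𝕜 := 𝕜) hV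
  linarith [h T ψ hψ, norm_sum_apply_eval_le S (ofTensor 𝕜 Ω X t) hψ,
    norm_sub_norm_le (tensorLift S t) (∑ w ∈ T, S (ψ w) (evalLinear w (ofTensor 𝕜 Ω X t)))]

theorem denseRange_ofTensor [T2Space Ω] [CompleteSpace X] : DenseRange (ofTensor 𝕜 Ω X) := by
  intro f
  rw [Metric.mem_closure_range_iff]
  intro ε hε
  obtain ⟨x, hx⟩ : IsOneCompact 𝕜 (Set.range f.toContinuousMap) := f.2
  obtain ⟨y, hy, hyε, δ, hδ, hsmall⟩ := exists_small_hull (𝕜 := 𝕜) hx.1 (half_pos hε)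
  obtain ⟨V, hV, hf⟩ := exists_entourage_norm_sub_le f.toContinuousMap hδ
  obtain ⟨T, ψ, hψ⟩ := exists_isFinePartition (𝕜 := 𝕜) hV
  refine ⟨∑ w ∈ T, ψ w ⊗ₜ f.toContinuousMap w, ?_⟩
  rw [dist_eq_norm]
  refine lt_of_le_of_lt ((norm_le_of_mem (𝕜 := 𝕜) (f := f - ofTensor 𝕜 Ω X
    (∑ w ∈ T, ψ w ⊗ₜ f.toContinuousMap w)) ⟨y, ⟨hy, ?_⟩, rfl⟩).trans hyε) (half_lt_self hε)
  rintro _ ⟨v, rfl⟩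
  have : (f - ofTensor 𝕜 Ω X (∑ w ∈ T, ψ w ⊗ₜ f.toContinuousMap w)).toContinuousMap v
      = ∑ w ∈ T, ψ w v • (f.toContinuousMap v - f.toContinuousMap w) := by
    change evalLinear v (f - ofTensor 𝕜 Ω X _) = _
    rw [map_sub, map_sum, map_sum]
    simp only [ofTensor_tmul, eval_tmul, smul_sub, Finset.sum_sub_distrib, ← Finset.sum_smul,
      hψ.sum_eq_one v, one_smul]
    rfl
  rw [this]
  exact sum_smul_mem_hull T (hψ.sum_norm_le_one v) fun w _ h0 =>
    hsmall _ (sub_mem_hull (hx.2 ⟨v, rfl⟩) (hx.2 ⟨w, rfl⟩))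
      (hf v w (hψ.mem_of_ne_zero w v h0))

end

end C1

theorem corollary2p5 {𝕜 : Type*} [RCLike 𝕜]
    {Ω : Type*} [TopologicalSpace Ω] [CompactSpace Ω] [T2Space Ω]
    {X : Type*} [NormedAddCommGroup X] [NormedSpace 𝕜 X] [CompleteSpace X]
    {Y : Type*} [NormedAddCommGroup Y] [NormedSpace 𝕜 Y] [CompleteSpace Y]
    (S : C(Ω, 𝕜) →L[𝕜] X →L[𝕜] Y) :
    ∃ U : C1 𝕜 Ω X →L[𝕜] Y, C1.assoc U = S := by
  -- Fineness of partitions is measured by the uniformity of the compact Hausdorff space.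
  obtain ⟨u, hu⟩ : ∃ u : UniformSpace Ω, u.toTopologicalSpace = ‹TopologicalSpace Ω› :=
    ⟨uniformSpaceOfCompactR1, rfl⟩
  subst hu
  refine ⟨(C1.tensorLift S).extendOfNorm (C1.ofTensor 𝕜 Ω X), ?_⟩
  have hd : DenseRange (C1.ofTensor 𝕜 Ω X) := C1.denseRange_ofTensor
  have hn : ∃ C, ∀ t, ‖C1.tensorLift S t‖ ≤ C * ‖C1.ofTensor 𝕜 Ω X t‖ :=
    ⟨‖S‖, C1.norm_tensorLift_le S⟩
  refine ContinuousLinearMap.ext fun φ => ContinuousLinearMap.ext fun x => ?_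
  -- On `φ ⊗ₜ x` the two maps unfold to `tmul φ x` and `S φ x`.
  exact LinearMap.extendOfNorm_eq hd hn (φ ⊗ₜ x)
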